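/- For a finite Borel measure $\mu$ on $\mathbb{C}$ with compact support, let $$I(\mu)=\iint \log|z-w|\,d\mu(z)\,d\mu(w)\in[-\infty,\infty),$$ where $\log 0=-\infty$. A set $A\subseteq\mathbb{C}$ is called polar if $I(\mu)=-\infty$ for every finite Borel measure $\mu\neq 0$ on $\mathbb{C}$ whose support is a compact subset of $A$. Let $E$ be a closed polar subset of $\mathbb{C}$ and let $f:\mathbb{C}\setminus E\to\mathbb{C}$ be conformal, i.e. holomorphic and injective. Then $f$ extends to a Möbius map of the Riemann sphere $\widehat{\mathbb{C}}=\mathbb{C}\cup\{\infty\}$: there are $a,b,c,d\in\mathbb{C}$ with $ad-bc\neq 0$ such that the map $T(z)=\frac{az+b}{cz+d}$ on $\widehat{\mathbb{C}}$ satisfies $T(z)=f(z)$ for all $z\in\mathbb{C}\setminus E$. Furthermore, $\mathbb{C}\setminus f(\mathbb{C}\setminus E)$ is polar. -/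

import Mathlib

open MeasureTheory

/-- The kernel `log |z - w|` with values in `[-∞, ∞]`; it equals `-∞` on the diagonal `z = w`. -/
noncomputable def logKernel (p : ℂ × ℂ) : EReal :=
  ENNReal.log ‖p.1 - p.2‖ₑ

/-- The logarithmic energy `I(μ) = ∫∫ log |z - w| dμ(z) dμ(w)` of a measure `μ` on `ℂ`, with values
in `[-∞, ∞]`: the integral of the positive part of the kernel minus the integral of its negative
part. For a finite measure with compact support the first of these integrals is finite, so that
the difference is well defined, and it equals `-∞` exactly when the second one is infinite. -/
noncomputable def logEnergy (μ : Measure ℂ) : EReal :=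
  ((∫⁻ p, (logKernel p).toENNReal ∂(μ.prod μ) : ENNReal) : EReal) -
    ((∫⁻ p, (-logKernel p).toENNReal ∂(μ.prod μ) : ENNReal) : EReal)

/-- A set `E ⊆ ℂ` is polar if every nonzero finite Borel measure whose support is a compact subset
of `E` has energy `-∞`. -/
def IsPolar (E : Set ℂ) : Prop :=
  ∀ μ : Measure ℂ, IsFiniteMeasure μ → μ ≠ 0 → IsCompact μ.support → μ.support ⊆ E →
    logEnergy μ = ⊥

/-- A conformal map on `U` (onto its image): an injective holomorphic function on `U`. Only the
values of `f` on `U` matter. -/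
def IsConformalOn (f : ℂ → ℂ) (U : Set ℂ) : Prop :=
  DifferentiableOn ℂ f U ∧ Set.InjOn f U

/-- A Möbius map of the Riemann sphere `ℂ ∪ {∞}`: the action `z ↦ (a z + b) / (c z + d)` of an
invertible complex matrix `!![a, b; c, d]`. -/
def IsMoebius (T : OnePoint ℂ → OnePoint ℂ) : Prop :=
  ∃ g : GL (Fin 2) ℂ, ∀ z : OnePoint ℂ, T z = g • z

/-! ### Logarithmic energy and polar sets. -/

open Filter Topology
open scoped ENNReal

/-! Fix x outside E with f'(x) ≠ 0. Then 1/(f - f(x)) has a simple pole at x and, by injectivity, is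
bounded off any neighbourhood of x. Subtracting the polar part leaves a bounded holomorphic function
off E. Liouville's theorem off polar sets (`IsPolar.eq_of_bounded`) makes it constant, and solving
for f gives a Möbius map. Its inverse sends the complement of the image, minus at most one point,
into E, and polarity survives such maps (`IsPolar.of_fractionalLinear`).

Liouville rests on a maximum principle ignoring a compact polar set K (`IsPolar.norm_le_of_sphere`),
reached by an inversion. It multiplies powers of the function by monic polynomials that are tiny on
K (`IsPolar.exists_prod_norm_sub_le`). If no such polynomials existed, greedily chosen points of K
would have counting measures with a weak limit of finite energy. -/

/-- The negative part of the logarithmic kernel. -/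
noncomputable def negLogKernel (p : ℂ × ℂ) : ℝ≥0∞ := (-logKernel p).toENNReal

lemma measurable_logKernel : Measurable logKernel := by
  unfold logKernel
  exact ENNReal.measurable_log.comp (by fun_prop)

lemma measurable_negLogKernel : Measurable negLogKernel :=
  measurable_logKernel.neg.ereal_toENNReal

lemma negLogKernel_self (z : ℂ) : negLogKernel (z, z) = ⊤ := by
  simp [negLogKernel, logKernel]

lemma negLogKernel_of_ne {z w : ℂ} (h : z ≠ w) :
    negLogKernel (z, w) = ENNReal.ofReal (-Real.log ‖z - w‖) := by
  have hpos : 0 < ‖z - w‖ := norm_pos_iff.2 (sub_ne_zero.2 h)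
  rw [negLogKernel, logKernel, ← ofReal_norm, ENNReal.log_ofReal_of_pos hpos,
    ← EReal.coe_neg, EReal.toENNReal_of_ne_top (EReal.coe_ne_top _), EReal.toReal_coe]

lemma logEnergy_eq_bot_of_lintegral_eq_top {μ : Measure ℂ}
    (h : ∫⁻ p, negLogKernel p ∂(μ.prod μ) = ⊤) : logEnergy μ = ⊥ := by
  change _ - ((∫⁻ p, negLogKernel p ∂(μ.prod μ) : ℝ≥0∞) : EReal) = ⊥
  rw [h]
  simp

lemma lintegral_pos_logKernel_lt_top {μ : Measure ℂ} [IsFiniteMeasure μ]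
    (hμ : IsCompact μ.support) : ∫⁻ p, (logKernel p).toENNReal ∂(μ.prod μ) < ⊤ := by
  obtain ⟨R, hR⟩ := hμ.isBounded.subset_closedBall (0 : ℂ)
  have hae : ∀ᵐ z ∂μ, ‖z‖ ≤ R := by
    filter_upwards [Measure.support_mem_ae (μ := μ)] with z hz
    simpa using hR hz
  have h1 : ∀ᵐ p ∂(μ.prod μ), ‖p.1‖ ≤ R :=
    Measure.quasiMeasurePreserving_fst.ae hae
  have h2 : ∀ᵐ p ∂(μ.prod μ), ‖p.2‖ ≤ R :=
    Measure.quasiMeasurePreserving_snd.ae hae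
  have hbound : ∀ᵐ p ∂(μ.prod μ), (logKernel p).toENNReal ≤
      (ENNReal.log (ENNReal.ofReal (2 * |R| + 1))).toENNReal := by
    filter_upwards [h1, h2] with p hp1 hp2
    apply EReal.toENNReal_le_toENNReal
    apply ENNReal.log_monotone
    rw [← ofReal_norm]
    apply ENNReal.ofReal_le_ofReal
    have := norm_sub_le p.1 p.2
    have := le_abs_self R
    linarith
  refine (lintegral_mono_ae hbound).trans_lt ?_
  rw [lintegral_const]
  refine ENNReal.mul_lt_top ?_ (measure_lt_top _ _)
  rw [ENNReal.log_ofReal_of_pos (by positivity), lt_top_iff_ne_top]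
  simp

lemma logEnergy_eq_bot_iff {μ : Measure ℂ} [IsFiniteMeasure μ] (hμ : IsCompact μ.support) :
    logEnergy μ = ⊥ ↔ ∫⁻ p, negLogKernel p ∂(μ.prod μ) = ⊤ := by
  refine ⟨fun h => ?_, logEnergy_eq_bot_of_lintegral_eq_top⟩
  change _ - ((∫⁻ p, negLogKernel p ∂(μ.prod μ) : ℝ≥0∞) : EReal) = ⊥ at h
  by_contra hne
  have hpos := (lintegral_pos_logKernel_lt_top hμ).ne
  lift (∫⁻ p, negLogKernel p ∂(μ.prod μ)) to NNReal using hne with a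
  lift (∫⁻ p, (logKernel p).toENNReal ∂(μ.prod μ)) to NNReal using hpos with b
  have : ((b : ℝ) - (a : ℝ) : ℝ) = (⊥ : EReal) := by
    rw [EReal.coe_sub]; exact h
  exact EReal.coe_ne_bot _ this

/-- A polar set carries no nonzero finite measure of finite energy on a compact subset. -/
lemma IsPolar.lintegral_eq_top {E : Set ℂ} (hE : IsPolar E) {μ : Measure ℂ} [IsFiniteMeasure μ]
    (h0 : μ ≠ 0) {C : Set ℂ} (hC : IsCompact C) (hCE : C ⊆ E) (hμ : μ Cᶜ = 0) :
    ∫⁻ p, negLogKernel p ∂(μ.prod μ) = ⊤ := by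
  have hsub : μ.support ⊆ C := Measure.support_subset_of_isClosed hC.isClosed
    (mem_ae_iff.2 hμ)
  have hcpt : IsCompact μ.support := hC.of_isClosed_subset Measure.isClosed_support hsub
  exact (logEnergy_eq_bot_iff hcpt).1 (hE μ inferInstance h0 hcpt (hsub.trans hCE))

/-! ### Transport of polarity by fractional linear maps. -/

lemma negLogKernel_le_add {c : ℝ} (hc : 0 < c) {z w z' w' : ℂ}
    (h : c * ‖z - w‖ ≤ ‖z' - w'‖) :
    negLogKernel (z', w') ≤ negLogKernel (z, w) + ENNReal.ofReal (-Real.log c) := by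
  rcases eq_or_ne z w with rfl | hzw
  · simp [negLogKernel_self]
  have hpos : 0 < ‖z - w‖ := norm_pos_iff.2 (sub_ne_zero.2 hzw)
  have hpos' : 0 < ‖z' - w'‖ := (mul_pos hc hpos).trans_le h
  have hzw' : z' ≠ w' := sub_ne_zero.1 (norm_pos_iff.1 hpos')
  rw [negLogKernel_of_ne hzw, negLogKernel_of_ne hzw']
  refine le_trans (ENNReal.ofReal_le_ofReal ?_) ENNReal.ofReal_add_le
  have := Real.log_le_log (mul_pos hc hpos) h
  rw [Real.log_mul hc.ne' hpos.ne'] at this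
  linarith

/-- Polarity is transported by maps which are, off one point, continuous and expanding up to a
constant on compact sets. -/
lemma IsPolar.of_antilipschitz {E A : Set ℂ} (hE : IsPolar E) {φ : ℂ → ℂ} {a : ℂ}
    (hφm : Measurable φ) (hφ : ContinuousOn φ {a}ᶜ)
    (hanti : ∀ C : Set ℂ, IsCompact C → a ∉ C →
      ∃ c > 0, ∀ z ∈ C, ∀ w ∈ C, c * ‖z - w‖ ≤ ‖φ z - φ w‖)
    (hA : ∀ z ∈ A, z ≠ a → φ z ∈ E) : IsPolar A := by
  intro μ hfin h0 hcpt hsub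
  apply logEnergy_eq_bot_of_lintegral_eq_top
  by_contra hne
  -- An atom charges a diagonal point, where the kernel is infinite. So some compact part of the
  -- support away from `a` has positive mass, and it can be pushed into `E`.
  have hatom : μ {a} = 0 := by
    by_contra hpos
    apply hne
    have hae := setLIntegral_le_lintegral (μ := μ.prod μ) ({(a, a)} : Set (ℂ × ℂ)) negLogKernel
    rw [lintegral_singleton, negLogKernel_self, ← Set.singleton_prod_singleton,
      Measure.prod_prod, ENNReal.top_mul (mul_ne_zero hpos hpos)] at hae
    exact top_le_iff.1 hae
  obtain ⟨n, hn⟩ : ∃ n : ℕ, μ (μ.support \ Metric.ball a (1 / ((n : ℝ) + 1))) ≠ 0 := by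
    by_contra! hall
    have hunion : μ.support ⊆ {a} ∪ ⋃ n : ℕ, (μ.support \ Metric.ball a (1 / ((n : ℝ) + 1))) := by
      intro z hz
      rcases eq_or_ne z a with rfl | hza
      · simp
      · right
        obtain ⟨n, hn⟩ := exists_nat_one_div_lt (dist_pos.2 hza)
        exact Set.mem_iUnion.2 ⟨n, hz, by simpa using hn.le⟩
    have h1 : μ μ.support = 0 :=
      measure_mono_null hunion (measure_union_null hatom (measure_iUnion_null hall))
    exact h0 (Measure.measure_univ_eq_zero.1 (by
      rw [← Set.union_compl_self μ.support]
      exact measure_union_null h1 Measure.measure_compl_support))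
  set C := μ.support \ Metric.ball a (1 / ((n : ℝ) + 1)) with hCdef
  have hC : IsCompact C := hcpt.diff Metric.isOpen_ball
  have haC : a ∉ C := fun h => h.2 (Metric.mem_ball_self (by positivity))
  have hCa : C ⊆ {a}ᶜ := fun z hz hza => haC (hza ▸ hz)
  obtain ⟨c, hc, hcC⟩ := hanti C hC haC
  set ν := (μ.restrict C).map φ with hν
  have hν0 : ν ≠ 0 := by
    rw [hν, Ne, Measure.map_eq_zero_iff hφm.aemeasurable, Measure.restrict_eq_zero]
    exact hn
  have himg : IsCompact (φ '' C) := hC.image_of_continuousOn (hφ.mono hCa)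
  have hνC : ν (φ '' C)ᶜ = 0 := by
    rw [hν, Measure.map_apply hφm himg.measurableSet.compl,
      Measure.restrict_apply (hφm himg.measurableSet.compl)]
    convert measure_empty (μ := μ)
    ext z
    simp only [Set.mem_inter_iff, Set.mem_preimage, Set.mem_compl_iff, Set.mem_empty_iff_false,
      iff_false, not_and]
    exact fun h hz => h ⟨z, hz, rfl⟩
  have htop := hE.lintegral_eq_top hν0 himg
    (by rintro _ ⟨z, hz, rfl⟩; exact hA z (hsub hz.1) (hCa hz)) hνC
  rw [hν, Measure.map_prod_map _ _ hφm hφm,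
    lintegral_map measurable_negLogKernel (hφm.prodMap hφm), Measure.prod_restrict] at htop
  refine absurd htop (ne_of_lt ?_)
  calc ∫⁻ p in C ×ˢ C, negLogKernel (Prod.map φ φ p) ∂(μ.prod μ)
      ≤ ∫⁻ p in C ×ˢ C, (negLogKernel p + ENNReal.ofReal (-Real.log c)) ∂(μ.prod μ) := by
        refine setLIntegral_mono' (hC.measurableSet.prod hC.measurableSet) fun p hp => ?_
        exact negLogKernel_le_add hc (hcC _ hp.1 _ hp.2)
    _ ≤ ∫⁻ p, (negLogKernel p + ENNReal.ofReal (-Real.log c)) ∂(μ.prod μ) :=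
        setLIntegral_le_lintegral _ _
    _ < ⊤ := by
        rw [lintegral_add_right _ measurable_const, lintegral_const]
        exact ENNReal.add_lt_top.2 ⟨lt_top_iff_ne_top.2 hne,
          ENNReal.mul_lt_top ENNReal.ofReal_lt_top (measure_lt_top _ _)⟩

/-- Fractional linear maps pull polar sets back to polar sets. -/
lemma IsPolar.of_fractionalLinear {E A : Set ℂ} (hE : IsPolar E) {α β γ δ a : ℂ}
    (hdet : α * δ - β * γ ≠ 0) (ha : ∀ w, w ≠ a → γ * w + δ ≠ 0)
    (hA : ∀ z ∈ A, z ≠ a → (α * z + β) / (γ * z + δ) ∈ E) : IsPolar A := by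
  refine hE.of_antilipschitz (φ := fun z => (α * z + β) / (γ * z + δ)) (a := a) (by fun_prop)
    (ContinuousOn.div (by fun_prop) (by fun_prop) fun w hw => ha w hw) ?_ hA
  intro C hC haC
  obtain ⟨B, hB⟩ := hC.exists_bound_of_continuousOn (f := fun w => γ * w + δ) (by fun_prop)
  have hdet' : 0 < ‖α * δ - β * γ‖ := norm_pos_iff.2 hdet
  -- The difference of two values is det · (z - w) over the product of the two denominators, each at
  -- most `|B| + 1`.
  refine ⟨‖α * δ - β * γ‖ / (|B| + 1) ^ 2, by positivity, fun z hz w hw => ?_⟩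
  have hz0 : γ * z + δ ≠ 0 := ha z fun h => haC (h ▸ hz)
  have hw0 : γ * w + δ ≠ 0 := ha w fun h => haC (h ▸ hw)
  have hzB : ‖γ * z + δ‖ ≤ |B| + 1 := (hB z hz).trans (by linarith [le_abs_self B])
  have hwB : ‖γ * w + δ‖ ≤ |B| + 1 := (hB w hw).trans (by linarith [le_abs_self B])
  have heq : (α * z + β) / (γ * z + δ) - (α * w + β) / (γ * w + δ) =
      (α * δ - β * γ) * (z - w) / ((γ * z + δ) * (γ * w + δ)) := by
    rw [div_sub_div _ _ hz0 hw0]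
    congr 1
    ring
  have hz0' := norm_pos_iff.2 hz0
  have hw0' := norm_pos_iff.2 hw0
  simp only [heq, norm_div, norm_mul]
  rw [div_mul_eq_mul_div]
  apply div_le_div_of_nonneg_left (by positivity) (by positivity)
  rw [sq]
  gcongr

/-! ### Greedy points and small polynomials on compact polar sets. -/

/-- The sequence obtained by choosing every term as a function of the preceding ones. -/
noncomputable def greedySeq {X : Type*} (F : (n : ℕ) → (Fin n → X) → X) (n : ℕ) : X :=
  F n fun j => greedySeq F j.1
termination_by n
decreasing_by exact j.2

/-- The logarithmic kernel with a change of sign, truncated at distance `δ`. -/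
noncomputable def truncKernel (δ : ℝ) (p : ℂ × ℂ) : ℝ := -Real.log (max ‖p.1 - p.2‖ δ)

lemma continuous_truncKernel {δ : ℝ} (hδ : 0 < δ) : Continuous (truncKernel δ) := by
  unfold truncKernel
  refine (Continuous.log (by fun_prop) fun p => ?_).neg
  exact (lt_max_of_lt_right hδ).ne'

lemma truncKernel_self {δ : ℝ} (hδ : 0 < δ) (z : ℂ) : truncKernel δ (z, z) = -Real.log δ := by
  simp [truncKernel, hδ.le]

lemma truncKernel_swap (δ : ℝ) (z w : ℂ) : truncKernel δ (z, w) = truncKernel δ (w, z) := by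
  simp [truncKernel, norm_sub_rev]

lemma truncKernel_le {δ : ℝ} {z w : ℂ} (h : z ≠ w) :
    truncKernel δ (z, w) ≤ -Real.log ‖z - w‖ :=
  neg_le_neg (Real.log_le_log (norm_pos_iff.2 (sub_ne_zero.2 h)) (le_max_left _ _))

/-- The n diagonal terms are only linear in n, so after division by n² they vanish in the limit and
the bound -log ε does not depend on δ. -/
lemma sum_truncKernel_le {δ ε : ℝ} (hδ : 0 < δ) (hε : 0 < ε) (hε1 : ε ≤ 1) {z : ℕ → ℂ}
    (hz : ∀ n, ε ^ n ≤ ∏ j ∈ Finset.range n, ‖z n - z j‖) (n : ℕ) :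
    ∑ i ∈ Finset.range n, ∑ j ∈ Finset.range n, truncKernel δ (z i, z j) ≤
      (n : ℝ) ^ 2 * (-Real.log ε) + n * (-Real.log δ) := by
  have hL : 0 ≤ -Real.log ε := neg_nonneg.2 (Real.log_nonpos hε.le hε1)
  induction n with
  | zero => simp
  | succ n ih =>
    have hpos : 0 < ∏ j ∈ Finset.range n, ‖z n - z j‖ := (pow_pos hε n).trans_le (hz n)
    have hne : ∀ j ∈ Finset.range n, ‖z n - z j‖ ≠ 0 := fun j hj h0 =>
      hpos.ne' (Finset.prod_eq_zero hj h0)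
    have hrow : ∑ j ∈ Finset.range n, truncKernel δ (z n, z j) ≤ n * (-Real.log ε) := by
      calc ∑ j ∈ Finset.range n, truncKernel δ (z n, z j)
          ≤ ∑ j ∈ Finset.range n, -Real.log ‖z n - z j‖ :=
            Finset.sum_le_sum fun j hj =>
              truncKernel_le (sub_ne_zero.1 (norm_ne_zero_iff.1 (hne j hj)))
        _ = -Real.log (∏ j ∈ Finset.range n, ‖z n - z j‖) := by
            rw [Real.log_prod hne, Finset.sum_neg_distrib]
        _ ≤ -Real.log (ε ^ n) := neg_le_neg (Real.log_le_log (pow_pos hε n) (hz n))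
        _ = n * (-Real.log ε) := by rw [Real.log_pow]; ring
    have hcol : ∑ i ∈ Finset.range n, truncKernel δ (z i, z n) =
        ∑ j ∈ Finset.range n, truncKernel δ (z n, z j) :=
      Finset.sum_congr rfl fun j _ => truncKernel_swap _ _ _
    simp only [Finset.sum_range_succ, Finset.sum_add_distrib, hcol, truncKernel_self hδ]
    push_cast
    nlinarith

/-- The normalized counting measure of the first `n + 1` terms of a sequence. -/
noncomputable def countingAverage {X : Type*} [MeasurableSpace X] (z : ℕ → X) (n : ℕ) :
    Measure X :=
  ((n : ℝ≥0∞) + 1)⁻¹ • ∑ i ∈ Finset.range (n + 1), Measure.dirac (z i)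

instance {X : Type*} [MeasurableSpace X] (z : ℕ → X) (n : ℕ) :
    IsProbabilityMeasure (countingAverage z n) := by
  constructor
  simp [countingAverage, ENNReal.inv_mul_cancel]

lemma integral_countingAverage {X : Type*} [MeasurableSpace X]
    [MeasurableSingletonClass X] (z : ℕ → X) (n : ℕ) (g : X → ℝ) :
    ∫ x, g x ∂(countingAverage z n) = ((n : ℝ) + 1)⁻¹ * ∑ i ∈ Finset.range (n + 1), g (z i) := by
  rw [countingAverage, integral_smul_measure,
    integral_finsetSum_measure fun i _ => by exact integrable_dirac (by simp)]
  simp [ENNReal.toReal_add]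

lemma integral_prod_countingAverage {X : Type*} [MeasurableSpace X] [MetricSpace X]
    [BorelSpace X] [CompactSpace X] (z : ℕ → X) (n : ℕ) {g : X × X → ℝ} (hg : Continuous g) :
    ∫ x, g x ∂((countingAverage z n).prod (countingAverage z n)) =
      (((n : ℝ) + 1)⁻¹) ^ 2 *
        ∑ i ∈ Finset.range (n + 1), ∑ j ∈ Finset.range (n + 1), g (z i, z j) := by
  have hint : Integrable g ((countingAverage z n).prod (countingAverage z n)) :=
    hg.integrable_of_hasCompactSupport (HasCompactSupport.of_compactSpace g)
  rw [integral_prod _ hint]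
  have hin : ∀ x, ∫ y, g (x, y) ∂(countingAverage z n) =
      ((n : ℝ) + 1)⁻¹ * ∑ j ∈ Finset.range (n + 1), g (x, z j) := fun x =>
    integral_countingAverage z n _
  simp_rw [hin]
  rw [integral_countingAverage z n, sq, mul_assoc, ← Finset.mul_sum]

/-- A compact set carrying a sequence whose successive products of distances decay at most
geometrically carries a probability measure of bounded truncated energies. -/
lemma exists_probabilityMeasure_truncKernel_le {K : Set ℂ} (hK : IsCompact K) {ε : ℝ}
    (hε : 0 < ε) (hε1 : ε ≤ 1) {z : ℕ → K}
    (hz : ∀ n, ε ^ n ≤ ∏ j ∈ Finset.range n, ‖(z n : ℂ) - z j‖) :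
    ∃ μ : Measure K, IsProbabilityMeasure μ ∧ ∀ δ > 0,
      ∫ p, truncKernel δ ((p.1 : ℂ), (p.2 : ℂ)) ∂(μ.prod μ) ≤ -Real.log ε := by
  have : CompactSpace K := isCompact_iff_compactSpace.1 hK
  let μs : ℕ → ProbabilityMeasure K := fun n => ⟨countingAverage z n, inferInstance⟩
  -- A weak limit along an ultrafilter replaces extraction of a subsequence.
  let U : Ultrafilter ℕ := hyperfilter ℕ
  obtain ⟨μ, -, hμ⟩ := isCompact_univ.ultrafilter_le_nhds (U.map μs) (by simp)
  refine ⟨μ, inferInstance, fun δ hδ => ?_⟩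
  have hlim : Tendsto μs U (𝓝 μ) := hμ
  have hprod : Tendsto (fun n => (μs n).prod (μs n)) U (𝓝 (μ.prod μ)) :=
    (ProbabilityMeasure.continuous_prod.tendsto (μ, μ)).comp (hlim.prodMk_nhds hlim)
  have hcont : Continuous fun p : K × K => truncKernel δ ((p.1 : ℂ), (p.2 : ℂ)) :=
    (continuous_truncKernel hδ).comp (by fun_prop)
  have hint := (ProbabilityMeasure.tendsto_iff_forall_integral_tendsto.1 hprod)
    (BoundedContinuousFunction.mkOfCompact ⟨_, hcont⟩)
  have hbound : Tendsto (fun n : ℕ => -Real.log ε + (-Real.log δ) * (1 / ((n : ℝ) + 1))) atTop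
      (𝓝 (-Real.log ε)) := by
    simpa using (tendsto_one_div_add_atTop_nhds_zero_nat (𝕜 := ℝ)).const_mul (-Real.log δ)
      |>.const_add (-Real.log ε)
  refine le_of_tendsto_of_tendsto hint
    (hbound.mono_left (Nat.hyperfilter_le_atTop)) (Eventually.of_forall fun n => ?_)
  change ∫ p, truncKernel δ ((p.1 : ℂ), (p.2 : ℂ))
    ∂((countingAverage z n).prod (countingAverage z n)) ≤ _
  rw [integral_prod_countingAverage z n hcont]
  have hsum := sum_truncKernel_le hδ hε hε1 (z := fun n => (z n : ℂ)) hz (n + 1)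
  push_cast at hsum
  have hn : (0 : ℝ) < (n : ℝ) + 1 := by positivity
  refine (mul_le_mul_of_nonneg_left hsum (by positivity)).trans_eq ?_
  field_simp

/-- Prepares Fatou's lemma as the truncation is removed; the shift by log R will make the truncated
kernels nonnegative. -/
lemma negLogKernel_le_liminf {R : ℝ} {z w : ℂ} (hR : 1 ≤ R) :
    negLogKernel (z, w) ≤ liminf (fun n : ℕ =>
      ENNReal.ofReal (truncKernel (1 / ((n : ℝ) + 1)) (z, w) + Real.log R)) atTop := by
  have hlogR : 0 ≤ Real.log R := Real.log_nonneg hR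
  rcases eq_or_ne z w with rfl | hzw
  · rw [negLogKernel_self, top_le_iff]
    apply Tendsto.liminf_eq
    apply ENNReal.tendsto_ofReal_atTop.comp
    apply tendsto_atTop_add_const_right
    have h : ∀ n : ℕ, truncKernel (1 / ((n : ℝ) + 1)) (z, z) = Real.log ((n : ℝ) + 1) := by
      intro n
      rw [truncKernel_self (by positivity)]
      simp
    simp_rw [h]
    exact Real.tendsto_log_atTop.comp
      (tendsto_atTop_add_const_right _ _ tendsto_natCast_atTop_atTop)
  · rw [negLogKernel_of_ne hzw]
    have hpos : 0 < ‖z - w‖ := norm_pos_iff.2 (sub_ne_zero.2 hzw)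
    obtain ⟨N, hN⟩ := exists_nat_one_div_lt hpos
    apply le_liminf_of_le (by isBoundedDefault)
    filter_upwards [eventually_ge_atTop N] with n hn
    apply ENNReal.ofReal_le_ofReal
    have : 1 / ((n : ℝ) + 1) ≤ ‖z - w‖ :=
      (one_div_le_one_div_of_le (by positivity) (by gcongr)).trans hN.le
    simp only [truncKernel, max_eq_left this]
    linarith

/-- On a compact polar set there are monic polynomials, with zeros in the set, which are uniformly
as small as one likes relative to their degree. -/
lemma IsPolar.exists_prod_norm_sub_le {K : Set ℂ} (hpolar : IsPolar K) (hK : IsCompact K)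
    (hne : K.Nonempty) {ε : ℝ} (hε : 0 < ε) :
    ∃ n : ℕ, n ≠ 0 ∧ ∃ z : Fin n → K, ∀ x ∈ K, ∏ j, ‖x - z j‖ ≤ ε ^ n := by
  wlog hε1 : ε ≤ 1 generalizing ε
  · obtain ⟨n, hn, z, hz⟩ := this one_pos le_rfl
    exact ⟨n, hn, z, fun x hx => (hz x hx).trans (pow_le_pow_left₀ zero_le_one (le_of_not_ge hε1) n)⟩
  by_contra! hcon
  -- Failure of the claim lets any finite list be prolonged by a point far, in product, from it.
  have hF : ∀ n : ℕ, ∀ z : Fin n → K, ∃ x : K, ε ^ n ≤ ∏ j, ‖(x : ℂ) - z j‖ := by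
    intro n z
    rcases eq_or_ne n 0 with rfl | hn
    · exact ⟨⟨_, hne.some_mem⟩, by simp⟩
    · obtain ⟨x, hx, hlt⟩ := hcon n hn z
      exact ⟨⟨x, hx⟩, hlt.le⟩
  choose F hF using hF
  have hz : ∀ n, ε ^ n ≤ ∏ j ∈ Finset.range n, ‖((greedySeq F n : K) : ℂ) - (greedySeq F j : K)‖ := by
    intro n
    rw [Finset.prod_range]
    have := hF n fun j => greedySeq F j
    rwa [← greedySeq.eq_1 F n] at this
  obtain ⟨μ, hμ, hle⟩ := exists_probabilityMeasure_truncKernel_le hK hε hε1 hz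
  have : CompactSpace K := isCompact_iff_compactSpace.1 hK
  have hval : Measurable (Subtype.val : K → ℂ) := measurable_subtype_coe
  have hfin : IsProbabilityMeasure (μ.map Subtype.val) := Measure.isProbabilityMeasure_map
    hval.aemeasurable
  have htop := hpolar.lintegral_eq_top (μ := μ.map Subtype.val)
    (IsProbabilityMeasure.ne_zero _) hK subset_rfl (by
      rw [Measure.map_apply hval hK.measurableSet.compl]
      simp)
  rw [Measure.map_prod_map _ _ hval hval,
    lintegral_map measurable_negLogKernel (hval.prodMap hval)] at htop
  obtain ⟨B, hB⟩ := hK.isBounded.exists_norm_le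
  set R := 2 * |B| + 1 with hRdef
  have hR : 1 ≤ R := by have := abs_nonneg B; linarith
  have hKR : ∀ z ∈ K, ∀ w ∈ K, ‖z - w‖ ≤ R := fun z hz w hw =>
    (norm_sub_le z w).trans (by linarith [hB z hz, hB w hw, le_abs_self B])
  have hcont : ∀ n : ℕ, Continuous fun p : K × K =>
      truncKernel (1 / ((n : ℝ) + 1)) ((p.1 : ℂ), (p.2 : ℂ)) := fun n =>
    (continuous_truncKernel (by positivity)).comp (by fun_prop)
  have hmain : ∀ n : ℕ, ∫⁻ p : K × K, ENNReal.ofReal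
      (truncKernel (1 / ((n : ℝ) + 1)) ((p.1 : ℂ), (p.2 : ℂ)) + Real.log R) ∂(μ.prod μ) ≤
      ENNReal.ofReal (-Real.log ε + Real.log R) := by
    intro n
    have hint : Integrable (fun p : K × K =>
        truncKernel (1 / ((n : ℝ) + 1)) ((p.1 : ℂ), (p.2 : ℂ))) (μ.prod μ) :=
      (hcont n).integrable_of_hasCompactSupport (HasCompactSupport.of_compactSpace _)
    have hint' : Integrable (fun p : K × K => truncKernel (1 / ((n : ℝ) + 1))
        ((p.1 : ℂ), (p.2 : ℂ)) + Real.log R) (μ.prod μ) := hint.add (integrable_const _)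
    rw [← ofReal_integral_eq_lintegral_ofReal hint'
      (Eventually.of_forall fun p => ?_), integral_add hint (integrable_const _)]
    · apply ENNReal.ofReal_le_ofReal
      rw [integral_const, probReal_univ, one_smul]
      exact add_le_add_left (hle _ (by positivity)) _
    · have hδ : 1 / ((n : ℝ) + 1) ≤ R := (by
        rw [div_le_one (by positivity)]; linarith [n.cast_nonneg (α := ℝ)] : _ ≤ (1 : ℝ)).trans hR
      have := Real.log_le_log (lt_max_of_lt_right (by positivity))
        (max_le (hKR _ p.1.2 _ p.2.2) hδ)
      simp only [Pi.zero_apply, truncKernel]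
      linarith
  refine absurd htop (ne_of_lt ?_)
  calc ∫⁻ p : K × K, negLogKernel (Prod.map Subtype.val Subtype.val p) ∂(μ.prod μ)
      ≤ ∫⁻ p : K × K, liminf (fun n : ℕ => ENNReal.ofReal
          (truncKernel (1 / ((n : ℝ) + 1)) ((p.1 : ℂ), (p.2 : ℂ)) + Real.log R)) atTop
          ∂(μ.prod μ) := lintegral_mono fun p => negLogKernel_le_liminf hR
    _ ≤ liminf (fun n : ℕ => ∫⁻ p : K × K, ENNReal.ofReal
          (truncKernel (1 / ((n : ℝ) + 1)) ((p.1 : ℂ), (p.2 : ℂ)) + Real.log R) ∂(μ.prod μ))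
          atTop := lintegral_liminf_le fun n => ((hcont n).measurable.add_const _).ennreal_ofReal
    _ ≤ ENNReal.ofReal (-Real.log ε + Real.log R) :=
        liminf_le_of_frequently_le' (Frequently.of_forall hmain)
    _ < ⊤ := ENNReal.ofReal_lt_top

/-! ### Maximum principle and Liouville's theorem. -/

/-- Maximum principle: compact polar subsets of a disc are negligible for bounded holomorphic
functions. -/
lemma IsPolar.norm_le_of_sphere {K : Set ℂ} (hpolar : IsPolar K) (hK : IsCompact K)
    (hne : K.Nonempty) {R m M : ℝ} (hR : 0 < R) (hKR : K ⊆ Metric.ball 0 R) {H : ℂ → ℂ}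
    (hH : DifferentiableOn ℂ H Kᶜ) (hm : 0 < m) (hM : ∀ w ∉ K, ‖H w‖ ≤ M)
    (hsphere : ∀ w, ‖w‖ = R → ‖H w‖ ≤ m) {w : ℂ} (hw : w ∉ K) (hwR : ‖w‖ < R) : ‖H w‖ ≤ m := by
  wlog hM0 : 0 < M generalizing M
  · exact this (M := |M| + 1) (fun w hw => (hM w hw).trans (by linarith [le_abs_self M]))
      (by positivity)
  have hd : 0 < Metric.infDist w K := (hK.isClosed.notMem_iff_infDist_pos hne).1 hw
  set d := Metric.infDist w K with hddef
  have key : ∀ k : ℕ, ‖H w‖ ^ k * d ≤ m ^ k * (2 * R) := by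
    intro k
    -- Chosen so that `G` below has the same bound on the level set |p| = (2ε)^n as on the sphere.
    -- Taking n-th roots and letting k → ∞ then removes the factor 2R/d.
    set ε := m ^ k * R / M ^ k with hεdef
    have hε : 0 < ε := by positivity
    have hMε : M ^ k * (2 * ε) = m ^ k * (2 * R) := by rw [hεdef]; field_simp
    obtain ⟨n, hn, z, hz⟩ := hpolar.exists_prod_norm_sub_le hK hne hε
    -- Since |p| ≤ ε^n on `K` and n ≠ 0, the level (2ε)^n keeps the closure of the region `W` below
    -- off `K`.
    set p : ℂ → ℂ := fun x => ∏ j, (x - z j) with hp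
    have hpd : Differentiable ℂ p := by
      rw [hp]; fun_prop
    have hpn : ∀ x, ‖p x‖ = ∏ j, ‖x - z j‖ := fun x => by simp [hp, norm_prod]
    set S : Set ℂ := {x | (2 * ε) ^ n < ‖p x‖} with hS
    set G : ℂ → ℂ := fun x => H x ^ (n * k) * p x with hG
    have hGn : ∀ x, ‖G x‖ = (‖H x‖ ^ k) ^ n * ‖p x‖ := fun x => by
      simp [hG, ← pow_mul, mul_comm]
    have hsmall : ∀ x ∉ K, ‖p x‖ ≤ (2 * ε) ^ n → ‖G x‖ ≤ (m ^ k * (2 * R)) ^ n := by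
      intro x hx hpx
      rw [hGn, ← hMε, mul_pow]
      gcongr
      exact hM x hx
    have hpd' : d ^ n ≤ ‖p w‖ := by
      rw [hpn, ← Fin.prod_const]
      exact Finset.prod_le_prod (fun _ _ => hd.le) fun j _ => by
        rw [← dist_eq_norm]; exact Metric.infDist_le_dist_of_mem (z j).2
    have hGw : ‖G w‖ ≤ (m ^ k * (2 * R)) ^ n := by
      by_cases hwS : w ∈ S
      swap
      · exact hsmall w hw (not_lt.1 hwS)
      have hSo : IsOpen S := isOpen_lt continuous_const hpd.continuous.norm
      set W := Metric.ball (0 : ℂ) R ∩ S with hW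
      have hWo : IsOpen W := Metric.isOpen_ball.inter hSo
      have hcl : closure W ⊆ {x | ‖x‖ ≤ R ∧ (2 * ε) ^ n ≤ ‖p x‖} := by
        apply closure_minimal
        · exact fun x hx => ⟨(mem_ball_zero_iff.1 hx.1).le, hx.2.le⟩
        · exact (isClosed_le continuous_norm continuous_const).inter
            (isClosed_le continuous_const hpd.continuous.norm)
      have hclK : closure W ⊆ Kᶜ := by
        intro x hx hxK
        have h1 := (hcl hx).2
        have h2 := hz x hxK
        rw [← hpn] at h2
        have h3 : ε ^ n < (2 * ε) ^ n := pow_lt_pow_left₀ (by linarith) hε.le hn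
        linarith
      refine Complex.norm_le_of_forall_mem_frontier_norm_le (U := W)
        (Metric.isBounded_ball.subset Set.inter_subset_left) (f := G) ?_ ?_
        (subset_closure ⟨mem_ball_zero_iff.2 hwR, hwS⟩)
      · exact (((hH.mono hclK).pow _).mul hpd.differentiableOn).diffContOnCl
      · intro x hx
        have hxcl := hcl hx.1
        have hxW : x ∉ W := by rw [hWo.frontier_eq] at hx; exact hx.2
        by_cases hxS : x ∈ S
        · have hxR : ‖x‖ = R := le_antisymm hxcl.1
            (not_lt.1 fun h => hxW ⟨mem_ball_zero_iff.2 h, hxS⟩)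
          have hpR : ‖p x‖ ≤ (2 * R) ^ n := by
            rw [hpn, ← Fin.prod_const]
            refine Finset.prod_le_prod (fun _ _ => norm_nonneg _) fun j _ => ?_
            have := mem_ball_zero_iff.1 (hKR (z j).2)
            have := norm_sub_le x (z j)
            linarith
          rw [hGn, mul_pow]
          gcongr
          exact hsphere x hxR
        · exact hsmall x (hclK hx.1) (not_lt.1 hxS)
    rw [hGn] at hGw
    refine le_of_pow_le_pow_left₀ hn (by positivity) ?_
    rw [mul_pow]
    exact (mul_le_mul_of_nonneg_left hpd' (by positivity)).trans hGw
  by_contra! hlt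
  obtain ⟨k, hk⟩ := pow_unbounded_of_one_lt (2 * R / d) ((one_lt_div hm).2 hlt)
  have := key k
  rw [div_pow, div_lt_div_iff₀ hd (pow_pos hm k)] at hk
  linarith

/-- An inversion moves `z₁` to infinity and turns `E` with ∞ into a compact polar set. On large
circles the function is then close to its value at `z₁`. -/
lemma IsPolar.norm_le_of_bounded {E : Set ℂ} (hE : IsClosed E) (hpolar : IsPolar E) {h : ℂ → ℂ}
    (hh : DifferentiableOn ℂ h Eᶜ) {M : ℝ} (hM : ∀ z ∉ E, ‖h z‖ ≤ M) {z₁ z : ℂ} (hz₁ : z₁ ∉ E)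
    (hz : z ∉ E) : ‖h z‖ ≤ ‖h z₁‖ := by
  rcases eq_or_ne z z₁ with rfl | hne
  · exact le_rfl
  refine le_of_forall_pos_le_add fun η hη => ?_
  set φ : ℂ → ℂ := fun w => z₁ + w⁻¹ with hφ
  have hφd : DifferentiableOn ℂ φ {0}ᶜ := by
    intro w hw
    exact ((differentiableAt_inv hw).const_add z₁).differentiableWithinAt
  set K : Set ℂ := {w | w = 0 ∨ φ w ∈ E} with hK
  have hKc : Kᶜ = {0}ᶜ ∩ φ ⁻¹' Eᶜ := by
    ext w; simp [hK]
  have hKclosed : IsClosed K := by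
    rw [← isOpen_compl_iff, hKc]
    exact hφd.continuousOn.isOpen_inter_preimage isOpen_compl_singleton hE.isOpen_compl
  have hcont : ContinuousAt h z₁ :=
    (hh.differentiableAt (hE.isOpen_compl.mem_nhds hz₁)).continuousAt
  obtain ⟨s, hs, hsball⟩ : ∃ s > 0, ∀ x, dist x z₁ < s → x ∉ E ∧ ‖h x‖ ≤ ‖h z₁‖ + η := by
    have h1 : ∀ᶠ x in 𝓝 z₁, x ∉ E := hE.isOpen_compl.mem_nhds hz₁
    have h2 : ∀ᶠ x in 𝓝 z₁, ‖h x‖ < ‖h z₁‖ + η :=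
      hcont.norm.eventually_lt_const (lt_add_of_pos_right _ hη)
    exact Metric.eventually_nhds_iff.1 (h1.and (h2.mono fun _ => le_of_lt))
  have hsub : z - z₁ ≠ 0 := sub_ne_zero.2 hne
  set w := (z - z₁)⁻¹ with hw
  have hφw : φ w = z := by simp [hφ, hw]
  set R := max (1 / s) ‖w‖ + 1 with hR
  have hsR : 1 / s < R := (le_max_left _ _).trans_lt (lt_add_one _)
  have hwR : ‖w‖ < R := (le_max_right _ _).trans_lt (lt_add_one _)
  have hR0 : 0 < R := (norm_nonneg w).trans_lt hwR
  have hdist : ∀ x, R ≤ ‖x‖ → dist (φ x) z₁ < s := by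
    intro x hx
    rw [dist_eq_norm, hφ]
    simp only [add_sub_cancel_left, norm_inv]
    rw [inv_lt_comm₀ (hR0.trans_le hx) hs, ← one_div]
    exact hsR.trans_le hx
  have hKR : K ⊆ Metric.ball 0 R := by
    rintro x (rfl | hx)
    · simpa using hR0
    · rw [mem_ball_zero_iff]
      by_contra! hle
      exact (hsball _ (hdist x hle)).1 hx
  have hKpolar : IsPolar K := by
    refine hpolar.of_fractionalLinear (α := z₁) (β := 1) (γ := 1) (δ := 0) (a := 0) (by simp)
      (fun w hw => by simpa using hw) ?_
    rintro x (rfl | hx) hx0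
    · exact absurd rfl hx0
    · convert hx using 1
      rw [one_mul, add_zero, add_div, mul_div_cancel_right₀ _ hx0, one_div]
  have hKcpt : IsCompact K := Metric.isCompact_of_isClosed_isBounded hKclosed
    (Metric.isBounded_ball.subset hKR)
  have hwK : w ∉ K := by
    rintro (h0 | hwE)
    · exact inv_ne_zero hsub h0
    · exact hz (hφw ▸ hwE)
  have := hKpolar.norm_le_of_sphere hKcpt ⟨0, Or.inl rfl⟩ (m := ‖h z₁‖ + η) (M := M) hR0 hKR
    (H := h ∘ φ) (hh.comp (hφd.mono (by rw [hKc]; exact Set.inter_subset_left))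
      (by rw [hKc]; exact fun x hx => hx.2)) (by positivity)
    (fun x hx => hM _ fun hxE => hx (Or.inr hxE))
    (fun x hx => (hsball _ (hdist x hx.ge)).2) hwK hwR
  simpa [hφw] using this

/-- Liouville's theorem off a closed polar set. -/
lemma IsPolar.eq_of_bounded {E : Set ℂ} (hE : IsClosed E) (hpolar : IsPolar E) {h : ℂ → ℂ}
    (hh : DifferentiableOn ℂ h Eᶜ) {M : ℝ} (hM : ∀ z ∉ E, ‖h z‖ ≤ M) {z₁ z : ℂ} (hz₁ : z₁ ∉ E)
    (hz : z ∉ E) : h z = h z₁ := by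
  have := hpolar.norm_le_of_bounded hE (h := fun x => h x - h z₁) (hh.sub_const _)
    (M := M + ‖h z₁‖) (fun x hx => (norm_sub_le _ _).trans (by gcongr; exact hM x hx)) hz₁ hz
  rw [sub_self, norm_zero] at this
  exact sub_eq_zero.1 (norm_le_zero_iff.1 this)

/-! ### Conformal maps off a closed polar set. -/

lemma IsConformalOn.exists_deriv_ne_zero {f : ℂ → ℂ} {U : Set ℂ} (hf : IsConformalOn f U)
    (hU : IsOpen U) (hne : U.Nonempty) : ∃ z ∈ U, deriv f z ≠ 0 := by
  by_contra! hzero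
  obtain ⟨x, hx⟩ := hne
  obtain ⟨s, hs, hball⟩ := Metric.isOpen_iff.1 hU x hx
  obtain ⟨y, hy, hyx⟩ : ∃ y ∈ Metric.ball x s, y ≠ x :=
    ⟨x + (s / 2 : ℝ), by simp [abs_of_pos hs, hs], by simp [hs.ne']⟩
  have := Metric.isOpen_ball.is_const_of_deriv_eq_zero (convex_ball x s).isPreconnected
    (hf.1.mono hball) (fun z hz => hzero z (hball hz)) hy (Metric.mem_ball_self hs)
  exact hyx (hf.2 (hball hy) hx this)

/-- A conformal map stays away from the value at a point, off any neighbourhood of the point. -/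
lemma IsConformalOn.exists_le_norm_sub {f : ℂ → ℂ} {U : Set ℂ} (hf : IsConformalOn f U)
    (hU : IsOpen U) {x : ℂ} (hx : x ∈ U) (hd : deriv f x ≠ 0) {V : Set ℂ} (hV : V ∈ 𝓝 x) :
    ∃ ρ > 0, ∀ z ∈ U, z ∉ V → ρ ≤ ‖f z - f x‖ := by
  have han : AnalyticAt ℂ f x := hf.1.analyticAt (hU.mem_nhds hx)
  have hmap : map f (𝓝 x) = 𝓝 (f x) := han.hasStrictDerivAt.map_nhds_eq hd
  have himg : f '' (V ∩ U) ∈ 𝓝 (f x) := hmap ▸ image_mem_map (inter_mem hV (hU.mem_nhds hx))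
  obtain ⟨ρ, hρ, hball⟩ := Metric.mem_nhds_iff.1 himg
  refine ⟨ρ, hρ, fun z hz hzV => ?_⟩
  by_contra! hlt
  obtain ⟨y, hy, hyz⟩ := hball (show f z ∈ Metric.ball (f x) ρ by rwa [mem_ball_iff_norm])
  exact hzV (hf.2 hy.2 hz hyz ▸ hy.1)

/-- A conformal map off a closed polar set is fractional linear. -/
lemma IsConformalOn.exists_eq_fractionalLinear {E : Set ℂ} (hE : IsClosed E)
    (hpolar : IsPolar E) {f : ℂ → ℂ} (hf : IsConformalOn f Eᶜ) (hne : Eᶜ.Nonempty) :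
    ∃ a b c d : ℂ, a * d - b * c ≠ 0 ∧
      ∀ z ∈ Eᶜ, c * z + d ≠ 0 ∧ f z = (a * z + b) / (c * z + d) := by
  have hU : IsOpen Eᶜ := hE.isOpen_compl
  obtain ⟨x, hx, hd⟩ := hf.exists_deriv_ne_zero hU hne
  have hF : ∀ z ∈ Eᶜ, dslope f x z ≠ 0 := by
    intro z hz
    rcases eq_or_ne z x with rfl | hzx
    · rwa [dslope_same]
    · rw [dslope_of_ne _ hzx, slope_def_field]
      exact div_ne_zero (sub_ne_zero.2 fun h => hzx (hf.2 hz hx h)) (sub_ne_zero.2 hzx)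
  set Φ : ℂ → ℂ := fun z => (dslope f x z)⁻¹ with hΦ
  -- `Φ` is (z - x)/(f z - f x), so its own difference quotient at x is 1/(f - f x) with the pole
  -- removed.
  have hΦd : DifferentiableOn ℂ Φ Eᶜ :=
    ((Complex.differentiableOn_dslope (hU.mem_nhds hx)).2 hf.1).inv hF
  set h := dslope Φ x with hh
  have hhd : DifferentiableOn ℂ h Eᶜ := (Complex.differentiableOn_dslope (hU.mem_nhds hx)).2 hΦd
  have hval : ∀ z ∈ Eᶜ, z ≠ x → h z = (f z - f x)⁻¹ - Φ x / (z - x) := by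
    intro z hz hzx
    have h1 : f z - f x ≠ 0 := sub_ne_zero.2 fun h => hzx (hf.2 hz hx h)
    have h2 : z - x ≠ 0 := sub_ne_zero.2 hzx
    rw [hh, dslope_of_ne _ hzx, slope_def_field, sub_div]
    congr 1
    simp only [hΦ, dslope_of_ne _ hzx, slope_def_field]
    field_simp
  obtain ⟨M, hM⟩ : ∃ M, ∀ z ∉ E, ‖h z‖ ≤ M := by
    have hcont : ContinuousAt h x := (hhd.differentiableAt (hU.mem_nhds hx)).continuousAt
    have hV : {z | ‖h z‖ < ‖h x‖ + 1} ∈ 𝓝 x := hcont.norm.eventually_lt_const (lt_add_one _)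
    obtain ⟨s, hs, hball⟩ := Metric.mem_nhds_iff.1 hV
    obtain ⟨ρ, hρ, hfar⟩ := hf.exists_le_norm_sub hU hx hd (Metric.ball_mem_nhds x hs)
    refine ⟨max (‖h x‖ + 1) (ρ⁻¹ + ‖Φ x‖ / s), fun z hz => ?_⟩
    by_cases hzs : z ∈ Metric.ball x s
    · exact (hball hzs).le.trans (le_max_left _ _)
    · have hzx : z ≠ x := fun h => hzs (h ▸ Metric.mem_ball_self hs)
      have hsz : s ≤ ‖z - x‖ := by simpa [dist_eq_norm] using hzs
      rw [hval z hz hzx]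
      refine (norm_sub_le _ _).trans (le_trans ?_ (le_max_right _ _))
      rw [norm_inv, norm_div]
      gcongr
      exact hfar z hz hzs
  set c := h x with hc
  set r := Φ x with hr
  have hr0 : r ≠ 0 := inv_ne_zero (hF x hx)
  -- Obtained by solving 1/(f z - f x) = c + r/(z - x); the determinant is r.
  refine ⟨f x * c + 1, f x * (r - c * x) - x, c, r - c * x, ?_, fun z hz => ?_⟩
  · convert hr0 using 1
    ring
  · have hden : c * z + (r - c * x) = c * (z - x) + r := by ring
    rcases eq_or_ne z x with rfl | hzx
    · rw [hden]
      refine ⟨by simpa using hr0, ?_⟩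
      rw [eq_div_iff (by simpa using hr0)]
      ring
    · have h1 : f z - f x ≠ 0 := sub_ne_zero.2 fun h => hzx (hf.2 hz hx h)
      have h2 : z - x ≠ 0 := sub_ne_zero.2 hzx
      have hconst : c = (f z - f x)⁻¹ - r / (z - x) := by
        rw [← hval z hz hzx, hc]
        exact (hpolar.eq_of_bounded hE hhd hM hx hz).symm
      have hmul : (c * (z - x) + r) * (f z - f x) = z - x := by
        rw [hconst]
        field_simp
        ring
      have hden0 : c * z + (r - c * x) ≠ 0 := by
        rw [hden]
        exact left_ne_zero_of_mul (hmul ▸ h2)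
      refine ⟨hden0, ?_⟩
      rw [eq_div_iff hden0]
      linear_combination hmul

theorem theorem3p1 (E : Set ℂ) (hE : IsClosed E) (hEpolar : IsPolar E)
    (f : ℂ → ℂ) (hf : IsConformalOn f Eᶜ) :
    (∃ T : OnePoint ℂ → OnePoint ℂ, IsMoebius T ∧
      ∀ z ∈ Eᶜ, T (z : OnePoint ℂ) = (f z : OnePoint ℂ)) ∧
    IsPolar (f '' Eᶜ)ᶜ := by
  rcases Eᶜ.eq_empty_or_nonempty with hempty | hne
  -- If `E` is the whole plane, the complement of the image is `E` itself, so no proof that the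
  -- plane is not polar is needed.
  · refine ⟨⟨id, ⟨1, fun z => (one_smul _ z).symm⟩, by simp [hempty]⟩, ?_⟩
    rw [hempty, Set.image_empty, Set.compl_empty, ← Set.compl_empty_iff.1 hempty]
    exact hEpolar
  obtain ⟨a, b, c, d, hdet, hval⟩ := hf.exists_eq_fractionalLinear hE hEpolar hne
  obtain ⟨g, h00, h01, h10, h11⟩ : ∃ g : GL (Fin 2) ℂ,
      g 0 0 = a ∧ g 0 1 = b ∧ g 1 0 = c ∧ g 1 1 = d :=
    ⟨Matrix.GeneralLinearGroup.mkOfDetNeZero !![a, b; c, d] (by rwa [Matrix.det_fin_two_of]),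
      rfl, rfl, rfl, rfl⟩
  refine ⟨⟨fun z => g • z, ⟨g, fun _ => rfl⟩, fun z hz => ?_⟩, ?_⟩
  · obtain ⟨hden, hfz⟩ := hval z hz
    simp only [OnePoint.smul_some_eq_ite, h00, h01, h10, h11, if_neg hden, hfz]
  -- The pole a/c of the inverse map; if c = 0 there is none and any point serves.
  · have hpole : ∃ e : ℂ, ∀ w, w ≠ e → -c * w + a ≠ 0 := by
      rcases eq_or_ne c 0 with rfl | hc
      · exact ⟨0, fun w _ h => hdet (by
          rw [show a = 0 by simpa using h]; simp)⟩
      · refine ⟨a / c, fun w hw h => hw ?_⟩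
        rw [eq_div_iff hc]
        linear_combination -h
    obtain ⟨e, he⟩ := hpole
    refine hEpolar.of_fractionalLinear (α := d) (β := -b) (γ := -c) (δ := a) (a := e)
      (by convert hdet using 1; ring) he fun w hw hwe => ?_
    by_contra hE'
    refine hw ⟨_, hE', ?_⟩
    have hw0 := he w hwe
    obtain ⟨hden, hfw⟩ := hval _ hE'
    rw [hfw, div_eq_iff hden]
    linear_combination div_mul_cancel₀ (d * w + -b) hw0
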